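/- **Proposition 2 (Normal form along an orbit segment).** Let $M$ be a real-analytic manifold of dimension $n$, and let $\mathcal D\subset TM$ be a real-analytic distribution of rank $m<n$, with annihilator $\mathcal D^\perp\subset T^*M$. Let $\underline H:T^*M\to\mathbb R$ be a real-analytic $\mathcal D$-Hamiltonian, i.e. $\underline H(q,p+P)=\underline H(q,p)$ for all $P\in\mathcal D_q^\perp$, and $\partial^2_{pp}\underline H(q,p)(\xi,\xi)>0$ for all $\xi\in T_q^*M\setminus\mathcal D_q^\perp$. Let $T>0$ and let $\underline\theta=(\underline Q,\underline P):[0,T]\to T^*M$ be an orbit of the Hamiltonian vector field of $\underline H$ with $\dot{\underline Q}(0)\neq0$. Then there exist $\delta\in(0,T]$, an open neighbourhood $U\subset M$ of $\underline Q(0)$, a real-analytic diffeomorphism $\varphi:U\to V$ onto an open set $V\subset\mathbb R^n$ with $\varphi(\underline Q(0))=0$, and a real-analytic function $g:V\to\mathbb R$ with the following property. Put $$\Psi_\varphi(q,p)=\big(\varphi(q),(D\varphi^{-1})^Tp\big),\qquad \Psi^g(q,p)=\big(q,p+(Dg)^T(q)\big),$$ which are maps $T^*U\to V\times\mathbb R^n$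 and $V\times\mathbb R^n\to V\times\mathbb R^n$, respectively, and $$\Phi:=\Psi_\varphi^{-1}\circ(\Psi^g)^{-1}:V\times\mathbb R^n\to T^*U,\qquad H:=\underline H\circ\Phi .$$ Then, with $e_1$ the first standard basis vector of $\mathbb R^n$: (a) for all $t\in[0,\delta]$, $\underline Q(t)\in U$ and $\theta(t):=\Phi^{-1}(\underline\theta(t))=(te_1,0)$; (b) $H(q,0)$ is constant for $q\in V$, equal to the value of $H$ along $\theta$; (c) $\partial_pH(q,0)=e_1$ for all $q\in V$. -/

import Mathlib

open scoped Manifold ContDiff Topology Gradient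
open Set Bundle

noncomputable section

namespace SubbundleHamiltonian

/-- The coordinate space `ℝⁿ`. -/
abbrev Rn (n : ℕ) : Type := EuclideanSpace ℝ (Fin n)

/-- The cotangent space `T*_q M`. -/
abbrev CotangentSpace (n : ℕ) {M : Type*} [TopologicalSpace M] [ChartedSpace (Rn n) M]
    (q : M) : Type _ :=
  TangentSpace (𝓡 n) q →L[ℝ] Bundle.Trivial M ℝ q

/-- The cotangent bundle `T*M`. It carries Mathlib's topology and manifold structure of a bundle
of continuous linear maps; its points are pairs `⟨q, p⟩` with `p ∈ T*_q M`. -/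
abbrev CotangentBundle (n : ℕ) (M : Type*) [TopologicalSpace M] [ChartedSpace (Rn n) M] :
    Type _ :=
  TotalSpace (Rn n →L[ℝ] ℝ) (fun q : M => CotangentSpace n q)

section

variable {n : ℕ} {M : Type*} [TopologicalSpace M] [ChartedSpace (Rn n) M]

/-- `D` is a real-analytic distribution of rank `m`: it is spanned, near every point, by `m`
pointwise linearly independent real-analytic vector fields. -/
def IsAnalyticDistribution [IsManifold (𝓡 n) ω M] (m : ℕ)
    (D : ∀ q : M, Submodule ℝ (TangentSpace (𝓡 n) q)) : Prop :=
  ∀ q₀ : M, ∃ U : Set M, IsOpen U ∧ q₀ ∈ U ∧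
    ∃ X : Fin m → ∀ q : M, TangentSpace (𝓡 n) q,
      (∀ i, ContMDiffOn (𝓡 n) (𝓡 n).tangent ω
        (fun q => (⟨q, X i q⟩ : TangentBundle (𝓡 n) M)) U) ∧
      ∀ q ∈ U, LinearIndependent ℝ (fun i => X i q) ∧
        D q = Submodule.span ℝ (Set.range fun i => X i q)

/-- The annihilator `D_q^⊥ ⊆ T*_q M` of `D_q`. -/
def annihilator (D : ∀ q : M, Submodule ℝ (TangentSpace (𝓡 n) q)) (q : M) :
    Set (CotangentSpace n q) :=
  {P | ∀ v ∈ D q, P v = 0}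

/-- `H` is a real-analytic `D`-Hamiltonian (sub-bundle Hamiltonian): it is real-analytic on `T*M`,
invariant under translation by `D^⊥` in the fibres, and the fibrewise Hessian
`∂²_pp H(q, p)(ξ, ξ) = d²/ds² H(q, p + s ξ)|_{s = 0}` is positive definite modulo `D_q^⊥`. -/
structure IsAnalyticDHamiltonian [IsManifold (𝓡 n) ω M]
    (D : ∀ q : M, Submodule ℝ (TangentSpace (𝓡 n) q)) (H : CotangentBundle n M → ℝ) : Prop where
  analytic : ContMDiff ((𝓡 n).prod 𝓘(ℝ, Rn n →L[ℝ] ℝ)) 𝓘(ℝ) ω H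
  invariant : ∀ (q : M) (p P : CotangentSpace n q), P ∈ annihilator D q →
    H ⟨q, p + P⟩ = H ⟨q, p⟩
  strictly_convex : ∀ (q : M) (p ξ : CotangentSpace n q), ξ ∉ annihilator D q →
    0 < iteratedDeriv 2 (fun s : ℝ => H ⟨q, p + s • ξ⟩) 0

/-- The cotangent lift `Ψ_φ(q, p) = (φ q, (Dφ⁻¹)ᵀ p)` of a local chart `φ` of `M`, with values in
`ℝⁿ × ℝⁿ` (a covector on `ℝⁿ` is identified with a vector through the dot product); it is
meaningful over the domain of `φ`. -/
def cotangentLift (φ : OpenPartialHomeomorph M (Rn n)) (x : CotangentBundle n M) :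
    Rn n × Rn n :=
  (φ x.1,
    (InnerProductSpace.toDual ℝ (Rn n)).symm
      (ContinuousLinearMap.comp (x.2 : Rn n →L[ℝ] ℝ)
        (mfderiv (𝓡 n) (𝓡 n) φ.symm (φ x.1) : Rn n →L[ℝ] Rn n)))

/-- The inverse `Ψ_φ⁻¹(y, η) = (φ⁻¹ y, (Dφ)ᵀ η)` of the cotangent lift of a local chart `φ`; it is
meaningful over the range of `φ`. -/
def cotangentLiftInv (φ : OpenPartialHomeomorph M (Rn n)) (z : Rn n × Rn n) :
    CotangentBundle n M :=
  ⟨φ.symm z.1,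
    (InnerProductSpace.toDual ℝ (Rn n) z.2).comp
      (mfderiv (𝓡 n) (𝓡 n) φ (φ.symm z.1) : TangentSpace (𝓡 n) (φ.symm z.1) →L[ℝ] Rn n)⟩

/-- The fibre translation `Ψ^g(q, p) = (q, p + (Dg)ᵀ(q))` of `ℝⁿ × ℝⁿ`. -/
def fiberTranslation (g : Rn n → ℝ) : Rn n × Rn n ≃ Rn n × Rn n where
  toFun z := (z.1, z.2 + ∇ g z.1)
  invFun z := (z.1, z.2 - ∇ g z.1)
  left_inv z := by simp
  right_inv z := by simp

/-- The partial gradient `∂_q F` of a function on `ℝⁿ × ℝⁿ`. -/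
def gradq (F : Rn n × Rn n → ℝ) (z : Rn n × Rn n) : Rn n := ∇ (fun q => F (q, z.2)) z.1

/-- The partial gradient `∂_p F` of a function on `ℝⁿ × ℝⁿ`. -/
def gradp (F : Rn n × Rn n → ℝ) (z : Rn n × Rn n) : Rn n := ∇ (fun p => F (z.1, p)) z.2

/-- `θ : [0, T] → T*M` is an orbit of the Hamiltonian vector field of `H` with respect to the
canonical symplectic form of `T*M`: it is continuous, and in the canonical coordinates of every
real-analytic chart of `M` it solves Hamilton's equations `q' = ∂_p H`, `p' = -∂_q H`. -/
structure IsHamiltonianOrbit [IsManifold (𝓡 n) ω M] (H : CotangentBundle n M → ℝ) (T : ℝ)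
    (θ : ℝ → CotangentBundle n M) : Prop where
  continuousOn : ContinuousOn θ (Icc 0 T)
  hamilton : ∀ φ ∈ IsManifold.maximalAtlas (𝓡 n) ω M, ∀ t ∈ Icc (0 : ℝ) T,
    (θ t).1 ∈ φ.source →
      HasDerivWithinAt (fun s => (cotangentLift φ (θ s)).1)
        (gradp (H ∘ cotangentLiftInv φ) (cotangentLift φ (θ t))) (Icc 0 T) t ∧
      HasDerivWithinAt (fun s => (cotangentLift φ (θ s)).2)
        (-gradq (H ∘ cotangentLiftInv φ) (cotangentLift φ (θ t))) (Icc 0 T) t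

end

end SubbundleHamiltonian

end

/-! In a chart the Hamiltonian becomes an analytic `K(q, p)`, and the nonzero initial velocity says
that `∂_p K ≠ 0` at the initial point `(q₀, p₀)`. The method of characteristics then solves `K(q,
dS(q)) = K(q₀, p₀)` with `dS(q₀) = p₀`: orbits of `K` start from a hypersurface transverse to the
velocity, with momenta on the energy level. Time along the orbits together with a parameter on the
hypersurface gives coordinates `Θ` in which the field `∂_p K(q, dS(q))` is the constant `e₁`
(`exists_hamiltonJacobi_coordinates`).

Translating fibres by `-dS` turns the graph of `dS` into the zero section. There the energy is
constant, and its momentum gradient is `e₁` because `Θ` straightens the velocity. The given orbit is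
the characteristic through `q₀`, by uniqueness for Hamilton's equations
(`exists_eqOn_of_hasDerivWithinAt`), so it becomes `(t e₁, 0)`.

That `P` is the differential of the action rests on `IsCharacteristicFamily.fderiv_action`: the
defect `dS - P dQ` is preserved by the flow when the energy is constant on the family. Analyticity
of everything rests on `exists_analyticAt_flow`, the implicit function theorem applied to the
integral equation of the flow in a space of continuous curves. -/

namespace SubbundleHamiltonian

/-! ### Analytic superposition operators on spaces of continuous functions -/

section Superposition

variable {X E F : Type*} [TopologicalSpace X] [CompactSpace X]
  [NormedAddCommGroup E] [NormedSpace ℝ E] [NormedAddCommGroup F] [NormedSpace ℝ F]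

/-- A continuous multilinear map, applied pointwise to continuous functions. -/
noncomputable def pointwiseMultilinear (X : Type*) [TopologicalSpace X] [CompactSpace X] {k : ℕ}
    (p : E [×k]→L[ℝ] F) : C(X, E) [×k]→L[ℝ] C(X, F) :=
  MultilinearMap.mkContinuous
    { toFun := fun v => ⟨fun t => p fun i => v i t, by fun_prop⟩
      map_update_add' := by
        intro _ v i a b
        have key : ∀ (c : C(X, E)) (t : X), (fun j => (Function.update v i c) j t) =
            Function.update (fun j => v j t) i (c t) := by
          intro c t
          ext j
          by_cases h : j = i
          · subst h; simp
          · simp [h]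
        ext t
        simp [key]
      map_update_smul' := by
        intro _ v i r a
        have key : ∀ (c : C(X, E)) (t : X), (fun j => (Function.update v i c) j t) =
            Function.update (fun j => v j t) i (c t) := by
          intro c t
          ext j
          by_cases h : j = i
          · subst h; simp
          · simp [h]
        ext t
        simp [key] } ‖p‖ (by
    intro v
    rw [ContinuousMap.norm_le _ (by positivity)]
    intro t
    refine (p.le_opNorm _).trans ?_
    gcongr with i
    exact (v i).norm_coe_le_norm t)

theorem norm_pointwiseMultilinear_le {k : ℕ} (p : E [×k]→L[ℝ] F) :
    ‖pointwiseMultilinear X p‖ ≤ ‖p‖ :=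
  MultilinearMap.mkContinuous_norm_le _ (norm_nonneg _) _

/-- The superposition operator `u ↦ f ∘ u` of an analytic function is analytic near a constant. -/
theorem exists_analyticAt_superposition [CompleteSpace F] {f : E → F} {x₀ : E}
    (hf : AnalyticAt ℝ f x₀) :
    ∃ N : C(X, E) → C(X, F), AnalyticAt ℝ N (ContinuousMap.const X x₀) ∧
      ∀ᶠ u in 𝓝 (ContinuousMap.const X x₀), ∀ t, N u t = f (u t) := by
  obtain ⟨p, r, hp⟩ := hf
  -- Applying each Taylor coefficient pointwise does not increase its norm, so the radius of
  -- convergence does not shrink.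
  let P : FormalMultilinearSeries ℝ C(X, E) C(X, F) := fun k => pointwiseMultilinear X (p k)
  have hPr : p.radius ≤ P.radius := by
    refine ENNReal.le_of_forall_nnreal_lt fun s hs => ?_
    obtain ⟨C, -, hC⟩ := p.norm_mul_pow_le_of_lt_radius hs
    refine P.le_radius_of_bound C fun k => le_trans ?_ (hC k)
    gcongr
    exact norm_pointwiseMultilinear_le (p k)
  have hPpos : 0 < P.radius := (hp.r_pos.trans_le hp.r_le).trans_le hPr
  have hP := P.hasFPowerSeriesOnBall hPpos
  -- `N` is the sum of the series rather than `f ∘ u`: the latter need not be continuous when `u`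
  -- leaves the neighbourhood of `x₀`.
  refine ⟨fun u => P.sum (u - ContinuousMap.const X x₀), ?_, ?_⟩
  · refine AnalyticAt.comp_of_eq (f := fun u => u - ContinuousMap.const X x₀)
      hP.analyticAt (by fun_prop) (by simp)
  · have hball : Metric.eball (ContinuousMap.const X x₀) r ∈ 𝓝 (ContinuousMap.const X x₀) :=
      Metric.eball_mem_nhds _ hp.r_pos
    filter_upwards [hball] with u hu t
    have hu' : u - ContinuousMap.const X x₀ ∈ Metric.eball (0 : C(X, E)) r := by
      simpa [edist_eq_enorm_sub] using hu
    have hut : u t - x₀ ∈ Metric.eball (0 : E) r := by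
      rw [Metric.mem_eball, edist_zero_right] at hu' ⊢
      refine lt_of_le_of_lt ?_ hu'
      rw [enorm_le_iff_norm_le]
      exact (u - ContinuousMap.const X x₀).norm_coe_le_norm t
    have h1 := hP.hasSum (Metric.eball_subset_eball (hp.r_le.trans hPr) hu')
    have h2 := h1.mapL (ContinuousMap.evalCLM ℝ t)
    have h3 := hp.hasSum hut
    simp only [zero_add, add_sub_cancel] at h2 h3
    exact h2.unique h3

end Superposition

/-! ### Analytic dependence of the flow on time and initial value -/

section Flow

variable {E : Type*} [NormedAddCommGroup E] [NormedSpace ℝ E]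

/-- The primitive vanishing at `0` of a continuous function on the unit interval. -/
noncomputable def primitive [CompleteSpace E] : C(unitInterval, E) →L[ℝ] C(unitInterval, E) :=
  LinearMap.mkContinuous
    { toFun := fun u => ⟨fun t => ∫ s in (0 : ℝ)..t, IccExtend zero_le_one u s, by
          have : Continuous fun b : ℝ => ∫ s in (0 : ℝ)..b, IccExtend zero_le_one u s :=
            intervalIntegral.continuous_primitive
              (fun a b => (u.continuous.Icc_extend' (h := zero_le_one)).intervalIntegrable a b) 0
          exact this.comp continuous_subtype_val⟩
      map_add' := by
        intro u v
        ext t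
        simp only [ContinuousMap.coe_mk, ContinuousMap.add_apply]
        rw [← intervalIntegral.integral_add
          ((u.continuous.Icc_extend' (h := zero_le_one)).intervalIntegrable _ _)
          ((v.continuous.Icc_extend' (h := zero_le_one)).intervalIntegrable _ _)]
        rfl
      map_smul' := by
        intro c u
        ext t
        simp only [ContinuousMap.coe_mk, ContinuousMap.smul_apply, RingHom.id_apply]
        rw [← intervalIntegral.integral_smul]
        rfl } 1 (by
    intro u
    rw [ContinuousMap.norm_le _ (by positivity)]
    intro t
    refine (intervalIntegral.norm_integral_le_of_norm_le_const (C := ‖u‖)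
      fun s _ => u.norm_coe_le_norm _).trans ?_
    have : |(t : ℝ) - 0| ≤ 1 := by
      rw [sub_zero, abs_of_nonneg t.2.1]
      exact t.2.2
    rw [one_mul]
    exact mul_le_of_le_one_right (norm_nonneg _) this)

theorem primitive_apply [CompleteSpace E] (u : C(unitInterval, E)) (t : unitInterval) :
    primitive u t = ∫ s in (0 : ℝ)..t, IccExtend zero_le_one u s := rfl

/-- The embedding of a space as the constant functions on the unit interval. -/
noncomputable def constCLM : E →L[ℝ] C(unitInterval, E) :=
  LinearMap.mkContinuous
    { toFun := fun x => ContinuousMap.const unitInterval x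
      map_add' := fun _ _ => rfl
      map_smul' := fun _ _ => rfl } 1 (by
    intro x
    rw [ContinuousMap.norm_le _ (by positivity)]
    intro t
    rw [one_mul]
    exact le_rfl)

theorem constCLM_apply (x : E) : constCLM x = ContinuousMap.const unitInterval x := rfl

/-- The local flow of an analytic vector field is analytic in time and initial value. -/
theorem exists_analyticAt_flow [CompleteSpace E] {f : E → E} {x₀ : E} (hf : AnalyticAt ℝ f x₀) :
    ∃ Fl : ℝ × E → E, AnalyticAt ℝ Fl (0, x₀) ∧
      ∀ᶠ z in 𝓝 ((0 : ℝ), x₀), Fl (0, z.2) = z.2 ∧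
        HasDerivAt (fun t => Fl (t, z.2)) (f (Fl z)) z.1 := by
  obtain ⟨N, hN, hNf⟩ := exists_analyticAt_superposition (X := unitInterval) hf
  let c₀ : C(unitInterval, E) := ContinuousMap.const unitInterval x₀
  -- Time is rescaled to the unit interval: near the constant curve, a zero `u` of `G ((t, x), ·)`
  -- satisfies `u(s) = x + t ∫₀ˢ f(u)`, so `u(1)` is the flow at time `t`. Time thereby becomes a
  -- parameter like `x`.
  let G : (ℝ × E) × C(unitInterval, E) → C(unitInterval, E) :=
    fun w => w.2 - constCLM w.1.2 - w.1.1 • primitive (N w.2)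
  let w₀ : (ℝ × E) × C(unitInterval, E) := ((0, x₀), c₀)
  have hGw₀ : G w₀ = 0 := by
    simp [G, w₀, c₀, constCLM_apply]
  have hG : AnalyticAt ℝ G w₀ := by
    have hN' : AnalyticAt ℝ (fun w : (ℝ × E) × C(unitInterval, E) => N w.2) w₀ :=
      AnalyticAt.comp_of_eq (f := Prod.snd) hN analyticAt_snd rfl
    have h1 : AnalyticAt ℝ (fun w : (ℝ × E) × C(unitInterval, E) => w.1.1) w₀ :=
      analyticAt_fst.comp_of_eq analyticAt_fst rfl
    have h2 : AnalyticAt ℝ (fun w : (ℝ × E) × C(unitInterval, E) => w.1.2) w₀ :=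
      analyticAt_snd.comp_of_eq analyticAt_fst rfl
    exact (analyticAt_snd.sub ((constCLM.analyticAt _).comp_of_eq h2 rfl)).sub
      (h1.smul ((primitive.analyticAt _).comp_of_eq hN' rfl))
  -- At `t = 0` the integral term drops out, and the derivative in the curve is the identity.
  have hinv : (fderiv ℝ G w₀ ∘L .inr ℝ (ℝ × E) C(unitInterval, E)).IsInvertible := by
    have h1 : HasFDerivAt (fun u => G ((0, x₀), u))
        (fderiv ℝ G w₀ ∘L .inr ℝ (ℝ × E) C(unitInterval, E)) c₀ :=
      HasFDerivAt.comp (f := fun u => (((0 : ℝ), x₀), u)) c₀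
        hG.differentiableAt.hasFDerivAt (hasFDerivAt_prodMk_right (𝕜 := ℝ) ((0 : ℝ), x₀) c₀)
    have h2 : HasFDerivAt (fun u => G ((0, x₀), u)) (.id ℝ C(unitInterval, E)) c₀ := by
      simpa [G] using (hasFDerivAt_id c₀).sub_const (constCLM x₀)
    rw [h1.unique h2]
    exact ⟨.refl ℝ _, rfl⟩
  have hGω : ContDiffAt ℝ ω G w₀ := hG.contDiffAt
  have hω : (ω : WithTop ℕ∞) ≠ 0 := by simp
  let ψ := hGω.implicitFunction hω hinv
  have hψ : AnalyticAt ℝ ψ (0, x₀) :=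
    (hGω.contDiffAt_implicitFunction hω hinv).analyticAt
  have hψiff := hGω.eventually_apply_eq_iff_implicitFunction hω hinv
  -- Picard–Lindelöf supplies a continuous flow `α`; the implicit function `ψ` supplies analyticity.
  -- They are identified in `hev`.
  obtain ⟨ε, hε, a, r, _, _, hr, hpl⟩ :=
    IsPicardLindelof.of_contDiffAt_one (hf.contDiffAt (n := 1))
  obtain ⟨α, hα, hαc⟩ := (hpl 0).exists_forall_mem_closedBall_eq_hasDerivWithinAt_continuousOn
  simp only [zero_sub, zero_add] at hα hαc
  have hUV : (Metric.closedBall x₀ (r : ℝ)) ×ˢ Icc (-ε) ε ∈ 𝓝 (x₀, (0 : ℝ)) :=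
    prod_mem_nhds (Metric.closedBall_mem_nhds _ hr) (Icc_mem_nhds (by linarith) hε)
  have hαx₀ : α (x₀, 0) = x₀ := (hα x₀ (Metric.mem_closedBall_self r.2)).1
  have hαca : Filter.Tendsto α (𝓝 (x₀, 0)) (𝓝 x₀) := by
    have := hαc.continuousAt hUV
    rwa [ContinuousAt, hαx₀] at this
  have hev : ∀ᶠ z in 𝓝 ((0 : ℝ), x₀), ψ z 1 = α (z.2, z.1) := by
    replace hψiff : ∀ᶠ w in 𝓝 ((0 : ℝ), x₀) ×ˢ 𝓝 c₀, G w = G w₀ ↔ ψ w.1 = w.2 := by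
      rw [← nhds_prod_eq]
      exact hψiff
    -- Closed balls for curves, since a pointwise bound only gives a non-strict bound in the sup
    -- norm.
    rw [Metric.nhds_basis_ball.prod Metric.nhds_basis_closedBall |>.eventually_iff] at hψiff
    obtain ⟨⟨d₁, d₂⟩, ⟨hd₁, hd₂⟩, hd⟩ := hψiff
    obtain ⟨d₃, hd₃, hd₃'⟩ := Metric.nhds_basis_closedBall.eventually_iff.1 hNf
    have hm : 0 < min d₂ d₃ := lt_min hd₂ hd₃
    have hα1 : ∀ᶠ y in 𝓝 (x₀, (0 : ℝ)), dist (α y) x₀ ≤ min d₂ d₃ :=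
      (hαca (Metric.closedBall_mem_nhds x₀ hm) :)
    rw [Metric.nhds_basis_ball.eventually_iff] at hα1
    obtain ⟨d₄, hd₄, hd₄'⟩ := hα1
    obtain ⟨d₅, hd₅, hd₅'⟩ := Metric.mem_nhds_iff.1 hUV
    have hm' : 0 < min d₁ (min d₄ d₅) := by positivity
    filter_upwards [Metric.ball_mem_nhds ((0 : ℝ), x₀) hm'] with z hz
    obtain ⟨hz1, hz4, hz5⟩ : z ∈ Metric.ball ((0 : ℝ), x₀) d₁ ∧
        z ∈ Metric.ball ((0 : ℝ), x₀) d₄ ∧ z ∈ Metric.ball ((0 : ℝ), x₀) d₅ := by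
      simp only [Metric.mem_ball, lt_inf_iff] at hz ⊢
      exact hz
    have hscale : ∀ d : ℝ, z ∈ Metric.ball ((0 : ℝ), x₀) d → ∀ s ∈ Icc (0 : ℝ) 1,
        (z.2, s * z.1) ∈ Metric.ball (x₀, (0 : ℝ)) d := by
      intro d hzd s hs
      simp only [Metric.mem_ball, Prod.dist_eq, max_lt_iff] at hzd ⊢
      refine ⟨hzd.2, lt_of_le_of_lt ?_ hzd.1⟩
      simp only [dist_zero_right, norm_mul, Real.norm_eq_abs]
      rw [abs_of_nonneg hs.1]
      exact mul_le_of_le_one_left (abs_nonneg _) hs.2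
    have hin : ∀ s ∈ Icc (0 : ℝ) 1, z.2 ∈ Metric.closedBall x₀ (r : ℝ) ∧ s * z.1 ∈ Icc (-ε) ε :=
      fun s hs => hd₅' (hscale d₅ hz5 s hs)
    have hcont : ContinuousOn (fun s : ℝ => α (z.2, s * z.1)) (Icc 0 1) :=
      hαc.comp (by fun_prop) fun s hs => hin s hs
    -- The rescaled orbit solves `G (z, c) = 0` and is uniformly close to `c₀`, so local uniqueness
    -- in the implicit function theorem forces `ψ z = c`.
    let c : C(unitInterval, E) := ⟨fun s => α (z.2, s * z.1), by
      simpa [continuousOn_iff_continuous_domRestrict] using! hcont⟩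
    have hcapp : ∀ t : unitInterval, c t = α (z.2, t * z.1) := fun _ => rfl
    have hcd : ∀ s, dist (c s) x₀ ≤ min d₂ d₃ := fun s => hd₄' (hscale d₄ hz4 s s.2)
    have hc : dist c c₀ ≤ min d₂ d₃ := (ContinuousMap.dist_le hm.le).2 hcd
    have hNc : ∀ t, N c t = f (c t) := hd₃' (hc.trans (min_le_right _ _))
    have hGc : G (z, c) = 0 := by
      ext t
      have hderiv : ∀ s ∈ Icc (0 : ℝ) 1, HasDerivWithinAt (fun s : ℝ => α (z.2, s * z.1))
          (z.1 • f (α (z.2, s * z.1))) (Icc 0 1) s := by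
        intro s hs
        have h1 := (hα z.2 (hin s hs).1).2 _ (hin s hs).2
        have h2 : HasDerivWithinAt (fun s : ℝ => s * z.1) z.1 (Icc 0 1) s := by
          simpa using ((hasDerivAt_id s).mul_const z.1).hasDerivWithinAt
        exact h1.scomp s h2 fun s hs => (hin s hs).2
      have hint : z.1 • primitive (N c) t = c t - z.2 := by
        rw [primitive_apply, ← intervalIntegral.integral_smul]
        have hIoo : Ioo (0 : ℝ) t ⊆ Ioo 0 1 := Ioo_subset_Ioo_right t.2.2
        have hcong : ∀ s ∈ Icc (0 : ℝ) 1, z.1 • IccExtend zero_le_one (N c) s =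
            z.1 • f (α (z.2, s * z.1)) := by
          intro s hs
          rw [IccExtend_of_mem _ _ hs, hNc]
          rfl
        rw [intervalIntegral.integral_eq_sub_of_hasDerivAt_of_le t.2.1
          (f := fun s : ℝ => α (z.2, s * z.1))
          (hcont.mono (Icc_subset_Icc_right t.2.2))]
        · have h0 : α (z.2, 0) = z.2 := (hα z.2 (hin 0 (by simp)).1).1
          simp [hcapp, h0]
        · intro s hs
          have hs' := hIoo hs
          rw [hcong s (Ioo_subset_Icc_self hs')]
          exact (hderiv s (Ioo_subset_Icc_self hs')).hasDerivAt (Icc_mem_nhds hs'.1 hs'.2)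
        · exact (((N c).continuous.Icc_extend' (h := zero_le_one)).const_smul
            z.1).intervalIntegrable _ _
      simp only [G, ContinuousMap.sub_apply, ContinuousMap.smul_apply, hint, constCLM_apply,
        ContinuousMap.const_apply, ContinuousMap.zero_apply, sub_self]
    have hiff := hd (show (z, c) ∈ _ from ⟨hz1, hc.trans (min_le_left _ _)⟩)
    have hz : ψ z = c := hiff.1 (hGc.trans hGw₀.symm)
    rw [hz]
    simp [hcapp]
  let ev : C(unitInterval, E) →L[ℝ] E := ContinuousMap.evalCLM ℝ 1
  have hevψ : AnalyticAt ℝ (fun z => ev (ψ z)) (0, x₀) := (ev.analyticAt _).comp hψ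
  refine ⟨fun z => ψ z 1, hevψ, ?_⟩
  have hc0 : Filter.Tendsto (fun z : ℝ × E => ((0 : ℝ), z.2)) (𝓝 ((0 : ℝ), x₀))
      (𝓝 ((0 : ℝ), x₀)) := by
    have : Continuous fun z : ℝ × E => ((0 : ℝ), z.2) := by fun_prop
    exact this.tendsto' _ _ rfl
  have hsw : Filter.Tendsto (fun z : ℝ × E => (z.2, z.1)) (𝓝 ((0 : ℝ), x₀))
      (𝓝 (x₀, (0 : ℝ))) := by
    have : Continuous fun z : ℝ × E => (z.2, z.1) := by fun_prop
    exact this.tendsto' _ _ rfl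
  filter_upwards [hev.eventually_nhds, hc0.eventually hev,
    hsw.eventually (eventually_mem_nhds_iff.2 hUV)] with z hz hz0 hzU
  have hzU' := mem_of_mem_nhds hzU
  refine ⟨hz0.trans (hα z.2 hzU'.1).1, ?_⟩
  have hl : ∀ᶠ t in 𝓝 z.1, ψ (t, z.2) 1 = α (z.2, t) := by
    have : Filter.Tendsto (fun t : ℝ => (t, z.2)) (𝓝 z.1) (𝓝 z) :=
      Continuous.tendsto' (by fun_prop) _ _ rfl
    exact this.eventually hz
  rw [hz.self_of_nhds]
  have hIcc : Icc (-ε) ε ∈ 𝓝 z.1 := by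
    have : Filter.Tendsto (fun t : ℝ => (z.2, t)) (𝓝 z.1) (𝓝 (z.2, z.1)) :=
      Continuous.tendsto' (by fun_prop) _ _ rfl
    filter_upwards [this hzU] with t ht using ht.2
  exact ((hα z.2 hzU'.1).2 z.1 hzU'.2 |>.hasDerivAt hIcc).congr_of_eventuallyEq hl

end Flow

end SubbundleHamiltonian

namespace SubbundleHamiltonian

/-! ### Calculus with a distinguished time variable -/

section Calculus

variable {E F : Type*} [NormedAddCommGroup E] [NormedSpace ℝ E] [NormedAddCommGroup F]
  [NormedSpace ℝ F]

/-- Symmetry of second derivatives; it exchanges time and parameter derivatives of the action and of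
the position along characteristics. -/
theorem fderiv_fderiv_apply_comm {f : E → F} {z : E} [CompleteSpace F] (hf : AnalyticAt ℝ f z)
    (v w : E) :
    fderiv ℝ (fun y => fderiv ℝ f y v) z w = fderiv ℝ (fun y => fderiv ℝ f y w) z v := by
  have hd : DifferentiableAt ℝ (fderiv ℝ f) z := hf.fderiv.differentiableAt
  have key : ∀ v w : E, fderiv ℝ (fun y => fderiv ℝ f y v) z w =
      fderiv ℝ (fderiv ℝ f) z w v := by
    intro v w
    rw [fderiv_clm_apply hd (differentiableAt_const v)]
    simp
  rw [key, key]
  exact (hf.contDiffAt (n := ω)).isSymmSndFDerivAt (by simp) |>.eq _ _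

theorem fderiv_comp_clm_apply {G : Type*} [NormedAddCommGroup G] [NormedSpace ℝ G] {f : E → F}
    {L : G →L[ℝ] E} {z : G} (hf : DifferentiableAt ℝ f (L z)) (w : G) :
    fderiv ℝ (fun y => f (L y)) z w = fderiv ℝ f (L z) (L w) := by
  have := (HasFDerivAt.comp (f := L) _ hf.hasFDerivAt L.hasFDerivAt).fderiv
  exact congrArg (fun T => T w) this

theorem fderiv_apply_inr {f : ℝ × E → F} {z : ℝ × E} (hf : DifferentiableAt ℝ f z) (w : E) :
    fderiv ℝ f z (0, w) = fderiv ℝ (fun y => f (z.1, y)) z.2 w := by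
  have := (HasFDerivAt.comp (f := fun y => (z.1, y)) z.2 hf.hasFDerivAt
    (hasFDerivAt_prodMk_right (𝕜 := ℝ) z.1 z.2)).fderiv
  have h2 : fderiv ℝ (fun y => f (z.1, y)) z.2 = _ := this
  rw [h2]
  simp

theorem hasDerivAt_fst {f : ℝ × E → F} {z : ℝ × E} (hf : DifferentiableAt ℝ f z) :
    HasDerivAt (fun t => f (t, z.2)) (fderiv ℝ f z (1, 0)) z.1 := by
  have h1 : HasDerivAt (fun t : ℝ => (t, z.2)) (1, 0) z.1 :=
    (hasDerivAt_id z.1).prodMk (hasDerivAt_const z.1 z.2)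
  exact HasFDerivAt.comp_hasDerivAt (f := fun t : ℝ => (t, z.2)) z.1 hf.hasFDerivAt h1

/-- A function on a ball of `ℝ × E` with vanishing derivative in the first variable does not
depend on it. -/
theorem eq_of_fderiv_fst_eq_zero {f : ℝ × E → F} {r : ℝ}
    (hf : ∀ z ∈ Metric.ball (0 : ℝ × E) r, DifferentiableAt ℝ f z ∧ fderiv ℝ f z (1, 0) = 0)
    {z : ℝ × E} (hz : z ∈ Metric.ball (0 : ℝ × E) r) : f z = f (0, z.2) := by
  have hz' : ‖z.1‖ < r ∧ ‖z.2‖ < r := by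
    rw [mem_ball_zero_iff, Prod.norm_def] at hz
    exact max_lt_iff.1 hz
  have hmem : ∀ t ∈ Metric.ball (0 : ℝ) r, (t, z.2) ∈ Metric.ball (0 : ℝ × E) r := by
    intro t ht
    rw [mem_ball_zero_iff] at ht ⊢
    exact max_lt ht hz'.2
  have hder : ∀ t ∈ Metric.ball (0 : ℝ) r, HasDerivAt (fun t => f (t, z.2)) 0 t := by
    intro t ht
    obtain ⟨h1, h2⟩ := hf _ (hmem t ht)
    have := hasDerivAt_fst h1
    rwa [h2] at this
  exact Metric.isOpen_ball.is_const_of_deriv_eq_zero (convex_ball (0 : ℝ) r).isPreconnected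
    (fun t ht => (hder t ht).differentiableAt.differentiableWithinAt)
    (fun t ht => (hder t ht).deriv) (mem_ball_zero_iff.2 hz'.1)
    (Metric.mem_ball_self ((norm_nonneg _).trans_lt hz'.1))

end Calculus

/-! ### The method of characteristics for the Hamilton–Jacobi equation -/

section HamiltonJacobi

variable {V : Type*} [NormedAddCommGroup V] [InnerProductSpace ℝ V] [CompleteSpace V]

local notation "⟪" x ", " y "⟫" => inner ℝ x y

/-- The inverse of the Riesz isomorphism of a real Hilbert space, as a linear map. -/
noncomputable def riesz : (V →L[ℝ] ℝ) →L[ℝ] V :=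
  LinearMap.mkContinuous
    { toFun := fun l => (InnerProductSpace.toDual ℝ V).symm l
      map_add' := by simp
      map_smul' := by simp } 1 (by intro l; simp)

theorem riesz_apply (l : V →L[ℝ] ℝ) : riesz l = (InnerProductSpace.toDual ℝ V).symm l := rfl

theorem inner_riesz (l : V →L[ℝ] ℝ) (w : V) : ⟪riesz l, w⟫ = l w := by
  rw [riesz_apply]
  exact InnerProductSpace.toDual_symm_apply

/-- The partial gradient in the first variable. -/
noncomputable def gradFst (K : V × V → ℝ) (z : V × V) : V := riesz (fderiv ℝ K z ∘L .inl ℝ V V)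

/-- The partial gradient in the second variable. -/
noncomputable def gradSnd (K : V × V → ℝ) (z : V × V) : V := riesz (fderiv ℝ K z ∘L .inr ℝ V V)

theorem fderiv_eq_inner_grad (K : V × V → ℝ) (z ξ : V × V) :
    fderiv ℝ K z ξ = ⟪gradFst K z, ξ.1⟫ + ⟪gradSnd K z, ξ.2⟫ := by
  simp only [gradFst, gradSnd, inner_riesz, ContinuousLinearMap.comp_apply,
    ContinuousLinearMap.inl_apply, ContinuousLinearMap.inr_apply, ← map_add]
  simp

theorem analyticAt_gradFst {K : V × V → ℝ} {z : V × V} (hK : AnalyticAt ℝ K z) :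
    AnalyticAt ℝ (gradFst K) z := by
  let T : (V × V →L[ℝ] ℝ) →L[ℝ] V :=
    riesz ∘L (ContinuousLinearMap.compL ℝ V (V × V) ℝ).flip (.inl ℝ V V)
  exact (T.analyticAt (fderiv ℝ K z)).comp hK.fderiv

theorem analyticAt_gradSnd {K : V × V → ℝ} {z : V × V} (hK : AnalyticAt ℝ K z) :
    AnalyticAt ℝ (gradSnd K) z := by
  let T : (V × V →L[ℝ] ℝ) →L[ℝ] V :=
    riesz ∘L (ContinuousLinearMap.compL ℝ V (V × V) ℝ).flip (.inr ℝ V V)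
  exact (T.analyticAt (fderiv ℝ K z)).comp hK.fderiv

/-- Where `K` is differentiable, the gradient cut out of the total derivative agrees with that of
the restriction to a slice, which is what `gradq` in Hamilton's equations uses. -/
theorem hasGradientAt_fst {K : V × V → ℝ} {z : V × V} (hK : DifferentiableAt ℝ K z) :
    HasGradientAt (fun q => K (q, z.2)) (gradFst K z) z.1 := by
  rw [hasGradientAt_iff_hasFDerivAt, gradFst, riesz_apply, LinearIsometryEquiv.apply_symm_apply]
  exact HasFDerivAt.comp (f := fun q => (q, z.2)) z.1 hK.hasFDerivAt
    (hasFDerivAt_prodMk_left (𝕜 := ℝ) z.1 z.2)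

theorem hasGradientAt_snd {K : V × V → ℝ} {z : V × V} (hK : DifferentiableAt ℝ K z) :
    HasGradientAt (fun p => K (z.1, p)) (gradSnd K z) z.2 := by
  rw [hasGradientAt_iff_hasFDerivAt, gradSnd, riesz_apply, LinearIsometryEquiv.apply_symm_apply]
  exact HasFDerivAt.comp (f := fun p => (z.1, p)) z.2 hK.hasFDerivAt
    (hasFDerivAt_prodMk_right (𝕜 := ℝ) z.1 z.2)

/-- An energy level can be parametrised by moving the momentum in a direction in which the
energy is not stationary. -/
theorem exists_analyticAt_momentum {K : V × V → ℝ} {q₀ p₀ ν : V} (A : V →L[ℝ] V)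
    (hK : AnalyticAt ℝ K (q₀, p₀)) (hν : ⟪gradSnd K (q₀, p₀), ν⟫ = 1) :
    ∃ l : V → ℝ, AnalyticAt ℝ l 0 ∧ l 0 = 0 ∧
      ∀ᶠ σ in 𝓝 0, K (q₀ + A σ, p₀ + l σ • ν) = K (q₀, p₀) := by
  let G : V × ℝ → ℝ := fun w => K (q₀ + A w.1, p₀ + w.2 • ν)
  have hsub : AnalyticAt ℝ (fun w : V × ℝ => (q₀ + A w.1, p₀ + w.2 • ν)) (0, 0) := by
    refine AnalyticAt.prod ?_ ?_
    · exact analyticAt_const.add ((A.analyticAt _).comp analyticAt_fst)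
    · exact analyticAt_const.add (analyticAt_snd.smul analyticAt_const)
  have hG : AnalyticAt ℝ G (0, 0) := hK.comp_of_eq hsub (by simp)
  -- The derivative of the energy in the momentum parameter is `⟪∂_p K, ν⟫ = 1`.
  have hinv : (fderiv ℝ G (0, 0) ∘L .inr ℝ V ℝ).IsInvertible := by
    have h1 : HasFDerivAt (fun s => G (0, s)) (fderiv ℝ G (0, 0) ∘L .inr ℝ V ℝ) 0 :=
      HasFDerivAt.comp (f := fun s : ℝ => ((0 : V), s)) 0 hG.differentiableAt.hasFDerivAt
        (hasFDerivAt_prodMk_right (𝕜 := ℝ) (0 : V) (0 : ℝ))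
    have h2 : HasDerivAt (fun s : ℝ => (q₀, p₀ + s • ν)) (0, ν) 0 := by
      refine (hasDerivAt_const _ _).prodMk ?_
      simpa using ((hasDerivAt_id (0 : ℝ)).smul_const ν).const_add p₀
    have h3 : HasDerivAt (fun s => G (0, s)) 1 0 := by
      have := HasFDerivAt.comp_hasDerivAt_of_eq (f := fun s : ℝ => (q₀, p₀ + s • ν)) (0 : ℝ)
        hK.differentiableAt.hasFDerivAt h2 (by simp)
      rw [fderiv_eq_inner_grad] at this
      simp only [inner_zero_right, zero_add, hν] at this
      refine this.congr_of_eventuallyEq (Filter.Eventually.of_forall fun s => ?_)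
      simp [G]
    have h4 : fderiv ℝ G (0, 0) ∘L .inr ℝ V ℝ = .id ℝ ℝ := by
      rw [h1.unique h3.hasFDerivAt]
      ext
      simp
    rw [h4]
    exact ⟨.refl ℝ _, rfl⟩
  have hGω : ContDiffAt ℝ ω G (0, 0) := hG.contDiffAt
  have hω : (ω : WithTop ℕ∞) ≠ 0 := by simp
  refine ⟨hGω.implicitFunction hω hinv, (hGω.contDiffAt_implicitFunction hω hinv).analyticAt,
    hGω.implicitFunction_apply_self hω hinv, ?_⟩
  filter_upwards [hGω.eventually_apply_implicitFunction hω hinv] with σ hσ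
  simpa [G] using hσ

/-- A family of characteristics of the Hamilton-Jacobi equation of `K`: orbits `(Q, P)` of the
Hamiltonian vector field of `K`, depending analytically on a parameter, and their action `S`. -/
structure IsCharacteristicFamily (K : V × V → ℝ) (q p : V → V) (s : V → ℝ)
    (Q P : ℝ × V → V) (S : ℝ × V → ℝ) (z : ℝ × V) : Prop where
  analyticAt_energy : AnalyticAt ℝ K (Q z, P z)
  analyticAt_position : AnalyticAt ℝ Q z
  analyticAt_momentum : AnalyticAt ℝ P z
  analyticAt_action : AnalyticAt ℝ S z
  position_zero : Q (0, z.2) = q z.2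
  momentum_zero : P (0, z.2) = p z.2
  action_zero : S (0, z.2) = s z.2
  deriv_position : fderiv ℝ Q z (1, 0) = gradSnd K (Q z, P z)
  deriv_momentum : fderiv ℝ P z (1, 0) = -gradFst K (Q z, P z)
  deriv_action : fderiv ℝ S z (1, 0) = ⟪P z, gradSnd K (Q z, P z)⟫

/-- Adjoining the action as an extra unknown with `S' = ⟪P, ∂_p K⟫` makes Hamilton's equations one
analytic autonomous system, whose analytic flow is composed with the analytic initial data. -/
theorem exists_isCharacteristicFamily {K : V × V → ℝ} {q p : V → V} {s : V → ℝ}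
    (hK : AnalyticAt ℝ K (q 0, p 0)) (hq : AnalyticAt ℝ q 0) (hp : AnalyticAt ℝ p 0)
    (hs : AnalyticAt ℝ s 0) :
    ∃ (Q P : ℝ × V → V) (S : ℝ × V → ℝ),
      ∀ᶠ z in 𝓝 (0 : ℝ × V), IsCharacteristicFamily K q p s Q P S z := by
  let f : V × V × ℝ → V × V × ℝ := fun x =>
    (gradSnd K (x.1, x.2.1), -gradFst K (x.1, x.2.1), ⟪x.2.1, gradSnd K (x.1, x.2.1)⟫)
  let x₀ : V × V × ℝ := (q 0, p 0, s 0)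
  have hf : AnalyticAt ℝ f x₀ := by
    have h21 : AnalyticAt ℝ (fun x : V × V × ℝ => x.2.1) x₀ :=
      analyticAt_fst.comp_of_eq analyticAt_snd rfl
    have hx : AnalyticAt ℝ (fun x : V × V × ℝ => (x.1, x.2.1)) x₀ := analyticAt_fst.prod h21
    have h1 : AnalyticAt ℝ (fun x : V × V × ℝ => gradSnd K (x.1, x.2.1)) x₀ :=
      (analyticAt_gradSnd hK).comp_of_eq hx rfl
    have h2 : AnalyticAt ℝ (fun x : V × V × ℝ => gradFst K (x.1, x.2.1)) x₀ :=
      (analyticAt_gradFst hK).comp_of_eq hx rfl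
    refine h1.prod (h2.neg.prod ?_)
    exact ((innerSL ℝ (E := V)).analyticAt_bilinear _).comp_of_eq (h21.prod h1) rfl
  obtain ⟨Fl, hFl, hFl'⟩ := exists_analyticAt_flow hf
  let ι : ℝ × V → ℝ × V × V × ℝ := fun z => (z.1, q z.2, p z.2, s z.2)
  have hι : AnalyticAt ℝ ι 0 :=
    analyticAt_fst.prod ((hq.comp_of_eq analyticAt_snd rfl).prod
      ((hp.comp_of_eq analyticAt_snd rfl).prod (hs.comp_of_eq analyticAt_snd rfl)))
  let W : ℝ × V → V × V × ℝ := fun z => Fl (ι z)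
  have hW : AnalyticAt ℝ W 0 := hFl.comp_of_eq hι rfl
  have hι0 : Filter.Tendsto ι (𝓝 0) (𝓝 (0, x₀)) := hι.continuousAt
  have hW0 : W 0 = x₀ := (hι0.eventually hFl').self_of_nhds.1
  have hKW : ∀ᶠ z in 𝓝 (0 : ℝ × V), AnalyticAt ℝ K ((W z).1, (W z).2.1) := by
    have hc : Filter.Tendsto (fun z => ((W z).1, (W z).2.1)) (𝓝 0) (𝓝 (q 0, p 0)) := by
      have h : ContinuousAt (fun z => ((W z).1, (W z).2.1)) 0 := by
        have := hW.continuousAt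
        fun_prop
      simpa [ContinuousAt, hW0] using h
    exact hc.eventually hK.eventually_analyticAt
  refine ⟨fun z => (W z).1, fun z => (W z).2.1, fun z => (W z).2.2, ?_⟩
  filter_upwards [hι0.eventually hFl', hW.eventually_analyticAt, hKW] with z hz hWz hKz
  have hd : HasDerivAt (fun t => W (t, z.2)) (f (W z)) z.1 := hz.2
  have hd' := hd.unique (hasDerivAt_fst hWz.differentiableAt)
  have hD := hWz.differentiableAt.hasFDerivAt
  have hD1 : fderiv ℝ (fun z => (W z).1) z = _ := hD.fst.fderiv
  have hD21 : fderiv ℝ (fun z => (W z).2.1) z = _ := hD.snd.fst.fderiv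
  have hD22 : fderiv ℝ (fun z => (W z).2.2) z = _ := hD.snd.snd.fderiv
  have h0 : W (0, z.2) = (q z.2, p z.2, s z.2) := hz.1
  refine ⟨hKz, analyticAt_fst.comp hWz, analyticAt_fst.comp (analyticAt_snd.comp hWz),
    analyticAt_snd.comp (analyticAt_snd.comp hWz), ?_, ?_, ?_, ?_, ?_, ?_⟩
  · simp [h0]
  · simp [h0]
  · simp [h0]
  · rw [hD1]; simp [← hd', f]
  · rw [hD21]; simp [← hd', f]
  · rw [hD22]; simp [← hd', f]

variable {K : V × V → ℝ} {q p : V → V} {s : V → ℝ} {Q P : ℝ × V → V} {S : ℝ × V → ℝ} {r : ℝ}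

/-- If the initial data of a family of characteristics lie on an energy level, then so does the
whole family. -/
theorem IsCharacteristicFamily.energy_eq
    (h : ∀ z ∈ Metric.ball (0 : ℝ × V) r, IsCharacteristicFamily K q p s Q P S z) {E : ℝ}
    (hE : ∀ z ∈ Metric.ball (0 : ℝ × V) r, K (q z.2, p z.2) = E) {z : ℝ × V}
    (hz : z ∈ Metric.ball (0 : ℝ × V) r) : K (Q z, P z) = E := by
  have key : ∀ z ∈ Metric.ball (0 : ℝ × V) r,
      DifferentiableAt ℝ (fun z => K (Q z, P z)) z ∧
        fderiv ℝ (fun z => K (Q z, P z)) z (1, 0) = 0 := by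
    intro z hz
    have hz' := h z hz
    have hd := HasFDerivAt.comp (f := fun z => (Q z, P z)) z
      hz'.analyticAt_energy.differentiableAt.hasFDerivAt
      (hz'.analyticAt_position.differentiableAt.hasFDerivAt.prodMk
        hz'.analyticAt_momentum.differentiableAt.hasFDerivAt)
    refine ⟨hd.differentiableAt, ?_⟩
    have h2 : fderiv ℝ (fun z => K (Q z, P z)) z = _ := hd.fderiv
    rw [h2, ContinuousLinearMap.comp_apply, fderiv_eq_inner_grad]
    simp only [ContinuousLinearMap.prod_apply, hz'.deriv_position, hz'.deriv_momentum,
      inner_neg_right]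
    rw [real_inner_comm, add_neg_cancel]
  have h1 := eq_of_fderiv_fst_eq_zero key hz
  simp only [(h z hz).position_zero, (h z hz).momentum_zero, hE z hz] at h1
  exact h1

/-- If the initial data of a family of characteristics lie on an energy level and `ds = p dq` in
a direction, then `dS = P dQ` in that direction. -/
theorem IsCharacteristicFamily.fderiv_action
    (h : ∀ z ∈ Metric.ball (0 : ℝ × V) r, IsCharacteristicFamily K q p s Q P S z) {E : ℝ}
    (hE : ∀ z ∈ Metric.ball (0 : ℝ × V) r, K (q z.2, p z.2) = E) {w : V}
    (hw : ∀ z ∈ Metric.ball (0 : ℝ × V) r, fderiv ℝ s z.2 w = ⟪p z.2, fderiv ℝ q z.2 w⟫)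
    {z : ℝ × V} (hz : z ∈ Metric.ball (0 : ℝ × V) r) :
    fderiv ℝ S z (0, w) = ⟪P z, fderiv ℝ Q z (0, w)⟫ := by
  have hopen : ∀ z ∈ Metric.ball (0 : ℝ × V) r, Metric.ball (0 : ℝ × V) r ∈ 𝓝 z :=
    fun z hz => Metric.isOpen_ball.mem_nhds hz
  -- The time derivative of `R` is `⟪∂_w P, ∂_p K⟫ + ⟪∂_q K, ∂_w Q⟫`, the terms `⟪P, ∂_w ∂_t Q⟫`
  -- cancelling. This is the `w`-derivative of the constant energy, hence zero.
  let R : ℝ × V → ℝ := fun z => fderiv ℝ S z (0, w) - ⟪P z, fderiv ℝ Q z (0, w)⟫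
  have key : ∀ z ∈ Metric.ball (0 : ℝ × V) r,
      DifferentiableAt ℝ R z ∧ fderiv ℝ R z (1, 0) = 0 := by
    intro z hz
    have hz' := h z hz
    have hP := hz'.analyticAt_momentum.differentiableAt
    have hS' : ∀ v, DifferentiableAt ℝ (fun y => fderiv ℝ S y v) z := fun v =>
      hz'.analyticAt_action.fderiv.differentiableAt.clm_apply (differentiableAt_const v)
    have hQ' : ∀ v, DifferentiableAt ℝ (fun y => fderiv ℝ Q y v) z := fun v =>
      hz'.analyticAt_position.fderiv.differentiableAt.clm_apply (differentiableAt_const v)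
    have hPQ : ∀ v, DifferentiableAt ℝ (fun y => ⟪P y, fderiv ℝ Q y v⟫) z := fun v =>
      hP.inner ℝ (hQ' v)
    refine ⟨(hS' _).sub (hPQ _), ?_⟩
    have hsub : fderiv ℝ R z (1, 0) = fderiv ℝ (fun y => fderiv ℝ S y (0, w)) z (1, 0) -
        fderiv ℝ (fun y => ⟪P y, fderiv ℝ Q y (0, w)⟫) z (1, 0) := by
      have : fderiv ℝ R z = _ := ((hS' (0, w)).hasFDerivAt.sub (hPQ (0, w)).hasFDerivAt).fderiv
      rw [this]
      rfl
    have hS1 : (fun y => fderiv ℝ S y (1, 0)) =ᶠ[𝓝 z] fun y => ⟪P y, fderiv ℝ Q y (1, 0)⟫ := by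
      filter_upwards [hopen z hz] with y hy
      rw [(h y hy).deriv_action, (h y hy).deriv_position]
    have hen : fderiv ℝ (fun z => K (Q z, P z)) z (0, w) = 0 := by
      have : (fun z => K (Q z, P z)) =ᶠ[𝓝 z] fun _ => E := by
        filter_upwards [hopen z hz] with y hy
        exact IsCharacteristicFamily.energy_eq h hE hy
      rw [this.fderiv_eq]
      simp
    have hd : fderiv ℝ (fun z => K (Q z, P z)) z = _ :=
      (HasFDerivAt.comp (f := fun z => (Q z, P z)) z
        hz'.analyticAt_energy.differentiableAt.hasFDerivAt
        (hz'.analyticAt_position.differentiableAt.hasFDerivAt.prodMk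
          hP.hasFDerivAt)).fderiv
    rw [hd, ContinuousLinearMap.comp_apply, fderiv_eq_inner_grad] at hen
    simp only [ContinuousLinearMap.prod_apply] at hen
    rw [hsub, fderiv_fderiv_apply_comm hz'.analyticAt_action, hS1.fderiv_eq,
      fderiv_inner_apply ℝ hP (hQ' _), fderiv_inner_apply ℝ hP (hQ' _),
      fderiv_fderiv_apply_comm hz'.analyticAt_position (0, w) (1, 0), hz'.deriv_position,
      hz'.deriv_momentum, inner_neg_left]
    have hcomm := real_inner_comm (gradSnd K (Q z, P z)) (fderiv ℝ P z (0, w))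
    linarith
  have h0 : (0, z.2) ∈ Metric.ball (0 : ℝ × V) r := by
    rw [mem_ball_zero_iff, Prod.norm_def] at hz ⊢
    simpa using lt_of_le_of_lt (le_max_right _ _) hz
  have hnear : ∀ᶠ y in 𝓝 z.2, ((0 : ℝ), y) ∈ Metric.ball (0 : ℝ × V) r := by
    have : Filter.Tendsto (fun y : V => ((0 : ℝ), y)) (𝓝 z.2) (𝓝 (0, z.2)) :=
      Continuous.tendsto' (by fun_prop) _ _ rfl
    exact this (hopen _ h0)
  have hQ0 : (fun y => Q (0, y)) =ᶠ[𝓝 z.2] q := by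
    filter_upwards [hnear] with y hy using (h _ hy).position_zero
  have hS0 : (fun y => S (0, y)) =ᶠ[𝓝 z.2] s := by
    filter_upwards [hnear] with y hy using (h _ hy).action_zero
  have hR := eq_of_fderiv_fst_eq_zero key hz
  have hR0 : R (0, z.2) = 0 := by
    simp only [R]
    rw [fderiv_apply_inr (h _ h0).analyticAt_action.differentiableAt,
      fderiv_apply_inr (h _ h0).analyticAt_position.differentiableAt, hQ0.fderiv_eq,
      hS0.fderiv_eq, (h z hz).momentum_zero]
    exact sub_eq_zero.2 (hw _ hz)
  exact sub_eq_zero.1 (hR.trans hR0)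

/-- **Hamilton-Jacobi equation.** Near a point at which the energy depends on the momentum, the
Hamilton-Jacobi equation `K(q, dS(q)) = const` has an analytic solution with prescribed initial
momentum, together with analytic coordinates `Θ` straightening the velocity field
`∂_p K(q, dS(q))`; here `η = dS` and `S` are expressed in the coordinates `Θ`. -/
theorem exists_hamiltonJacobi_coordinates {q₀ p₀ e : V} (he : ‖e‖ = 1)
    (hK : AnalyticAt ℝ K (q₀, p₀)) (hv : gradSnd K (q₀, p₀) ≠ 0) :
    ∃ (Θ η : V → V) (S : V → ℝ) (A : V ≃L[ℝ] V), Θ 0 = q₀ ∧ η 0 = p₀ ∧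
      HasFDerivAt Θ (A : V →L[ℝ] V) 0 ∧
      ∀ᶠ z in 𝓝 0, AnalyticAt ℝ K (Θ z, η z) ∧ AnalyticAt ℝ Θ z ∧ AnalyticAt ℝ η z ∧
        AnalyticAt ℝ S z ∧ K (Θ z, η z) = K (q₀, p₀) ∧
        fderiv ℝ Θ z e = gradSnd K (Θ z, η z) ∧ fderiv ℝ η z e = -gradFst K (Θ z, η z) ∧
        ∀ w, fderiv ℝ S z w = ⟪η z, fderiv ℝ Θ z w⟫ := by
  have he0 : e ≠ 0 := fun h => by simp [h] at he
  have hee : ⟪e, e⟫ = 1 := by simp [he]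
  -- `A` sends `e` to the initial velocity, so `A(e^⊥)` is a transverse hyperplane. The covector `ν`
  -- vanishes on that hyperplane and is `1` on the velocity: correcting momenta along `ν` reaches
  -- the energy level without affecting `p dq` there.
  obtain ⟨A, hA⟩ := SeparatingDual.exists_continuousLinearEquiv_apply_eq (R := ℝ) he0 hv
  let ν : V := riesz (innerSL ℝ e ∘L (A.symm : V →L[ℝ] V))
  have hν : ∀ w, ⟪ν, A w⟫ = ⟪e, w⟫ := fun w => by simp [ν, inner_riesz]
  obtain ⟨l, hl, hl0, hlE⟩ := exists_analyticAt_momentum (A : V →L[ℝ] V) hK (ν := ν) (by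
    rw [real_inner_comm, ← hA, hν, hee])
  let q : V → V := fun σ => q₀ + A σ
  let p : V → V := fun σ => p₀ + l σ • ν
  let s : V → ℝ := fun σ => ⟪p₀, A σ⟫
  have hq' : ∀ σ, HasFDerivAt q (A : V →L[ℝ] V) σ := fun σ =>
    (A : V →L[ℝ] V).hasFDerivAt.const_add q₀
  have hs' : ∀ σ, HasFDerivAt s (innerSL ℝ p₀ ∘L (A : V →L[ℝ] V)) σ := fun σ =>
    (innerSL ℝ p₀ ∘L (A : V →L[ℝ] V)).hasFDerivAt
  have hq : AnalyticAt ℝ q 0 := analyticAt_const.add ((A : V →L[ℝ] V).analyticAt _)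
  have hp : AnalyticAt ℝ p 0 := analyticAt_const.add (hl.smul analyticAt_const)
  have hs : AnalyticAt ℝ s 0 := (innerSL ℝ p₀ ∘L (A : V →L[ℝ] V)).analyticAt _
  have hq0 : q 0 = q₀ := by simp [q]
  have hp0 : p 0 = p₀ := by simp [p, hl0]
  obtain ⟨Q, P, S, hchar⟩ := exists_isCharacteristicFamily (K := K) (by rwa [hq0, hp0]) hq hp hs
  have hsnd : Filter.Tendsto (fun z : ℝ × V => z.2) (𝓝 0) (𝓝 0) :=
    Continuous.tendsto' continuous_snd _ _ rfl
  obtain ⟨r, hr, hball⟩ := Metric.eventually_nhds_iff_ball.1 (hchar.and (hsnd.eventually hlE))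
  have h : ∀ z ∈ Metric.ball (0 : ℝ × V) r, IsCharacteristicFamily K q p s Q P S z :=
    fun z hz => (hball z hz).1
  have hE : ∀ z ∈ Metric.ball (0 : ℝ × V) r, K (q z.2, p z.2) = K (q₀, p₀) :=
    fun z hz => (hball z hz).2
  -- The `e`-component of a point is the time; its orthogonal component labels the characteristic.
  let L : V →L[ℝ] ℝ × V :=
    (innerSL ℝ e).prod (.id ℝ V - (innerSL ℝ e).smulRight e)
  have hL : ∀ w, L w = ⟪e, w⟫ • ((1 : ℝ), (0 : V)) + (0, w - ⟪e, w⟫ • e) := fun w => by simp [L]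
  have hLe : L e = (1, 0) := by simp [L, he]
  have hperp : ∀ w, ⟪e, w - ⟪e, w⟫ • e⟫ = 0 := fun w => by
    rw [inner_sub_right, inner_smul_right, hee, mul_one, sub_self]
  have hL0 : Filter.Tendsto L (𝓝 0) (𝓝 0) := by simpa using L.continuous.tendsto 0
  have h00 : (0 : ℝ × V) ∈ Metric.ball (0 : ℝ × V) r := Metric.mem_ball_self hr
  have hQ0 : Q 0 = q₀ := (h 0 h00).position_zero.trans hq0
  have hP0 : P 0 = p₀ := (h 0 h00).momentum_zero.trans hp0
  refine ⟨fun z => Q (L z), fun z => P (L z), fun z => S (L z), A, by simpa using hQ0,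
    by simpa using hP0, ?_, ?_⟩
  · have hd : DifferentiableAt ℝ Q (L 0) := by
      simpa using (h 0 h00).analyticAt_position.differentiableAt
    have hd' : HasFDerivAt (fun z => Q (L z)) _ 0 := HasFDerivAt.comp (f := L) 0 hd.hasFDerivAt
      L.hasFDerivAt
    convert! hd' using 1
    ext w
    have hnear : (fun y => Q (0, y)) =ᶠ[𝓝 0] q := by
      have : Filter.Tendsto (fun y : V => ((0 : ℝ), y)) (𝓝 0) (𝓝 0) :=
        Continuous.tendsto' (by fun_prop) _ _ rfl
      filter_upwards [this (Metric.ball_mem_nhds _ hr)] with y hy using (h _ hy).position_zero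
    rw [map_zero, ContinuousLinearMap.comp_apply, hL, map_add, map_smul,
      (h 0 h00).deriv_position, fderiv_apply_inr (h 0 h00).analyticAt_position.differentiableAt,
      Prod.fst_zero, Prod.snd_zero, hnear.fderiv_eq, (hq' 0).fderiv, hQ0, hP0, ← hA]
    simp
  · filter_upwards [hL0 (Metric.ball_mem_nhds _ hr)] with z hz
    have hz' := h _ hz
    refine ⟨hz'.analyticAt_energy, hz'.analyticAt_position.comp (L.analyticAt z),
      hz'.analyticAt_momentum.comp (L.analyticAt z), hz'.analyticAt_action.comp (L.analyticAt z),
      IsCharacteristicFamily.energy_eq h hE hz, ?_, ?_, fun w => ?_⟩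
    · rw [fderiv_comp_clm_apply hz'.analyticAt_position.differentiableAt, hLe, hz'.deriv_position]
    · rw [fderiv_comp_clm_apply hz'.analyticAt_momentum.differentiableAt, hLe, hz'.deriv_momentum]
    -- Transverse directions use conservation of the defect, the term `l σ • ν` being killed by
    -- `hperp`; the direction `e` uses the growth rate of the action.
    · have hw := IsCharacteristicFamily.fderiv_action h hE (w := w - ⟪e, w⟫ • e) (fun y hy => by
        rw [(hs' _).fderiv, (hq' _).fderiv]
        simp only [p, ContinuousLinearMap.comp_apply, innerSL_apply_apply,
          ContinuousLinearEquiv.coe_coe, inner_add_left, inner_smul_left, hν, hperp]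
        simp) hz
      rw [fderiv_comp_clm_apply hz'.analyticAt_action.differentiableAt,
        fderiv_comp_clm_apply hz'.analyticAt_position.differentiableAt, hL w, map_add, map_add, map_smul, map_smul,
        hw, hz'.deriv_action, hz'.deriv_position, inner_add_right, inner_smul_right, smul_eq_mul]

end HamiltonJacobi

end SubbundleHamiltonian

namespace SubbundleHamiltonian

/-! ### Analytic inverse functions and local uniqueness for ODEs -/

section Local

variable {E : Type*} [NormedAddCommGroup E] [NormedSpace ℝ E]

/-- The analytic inverse function theorem, on a neighbourhood on which a property that holds near
the base point is satisfied. -/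
theorem exists_analytic_openPartialHomeomorph [CompleteSpace E] {Θ : E → E} {A : E ≃L[ℝ] E}
    {a : E} (hΘ : AnalyticAt ℝ Θ a) (hA : HasFDerivAt Θ (A : E →L[ℝ] E) a) {good : E → Prop}
    (hgood : ∀ᶠ z in 𝓝 a, good z) :
    ∃ e : OpenPartialHomeomorph E E, (e : E → E) = Θ ∧ a ∈ e.source ∧
      (∀ z ∈ e.source, good z) ∧ ∀ y ∈ e.target, AnalyticAt ℝ e.symm y := by
  have hω : (ω : WithTop ℕ∞) ≠ 0 := by simp
  have hΘω : ContDiffAt ℝ ω Θ a := hΘ.contDiffAt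
  let e₀ := hΘω.toOpenPartialHomeomorph Θ hA hω
  have ha₀ : a ∈ e₀.source := hΘω.mem_toOpenPartialHomeomorph_source hA hω
  have hsymm : AnalyticAt ℝ e₀.symm (Θ a) := (hΘω.to_localInverse hA hω).analyticAt
  have hev : ∀ᶠ z in 𝓝 a, good z ∧ AnalyticAt ℝ e₀.symm (Θ z) :=
    hgood.and (hΘ.continuousAt.eventually hsymm.eventually_analyticAt)
  let U : Set E := interior {z | good z ∧ AnalyticAt ℝ e₀.symm (Θ z)}
  have haU : a ∈ U := mem_interior_iff_mem_nhds.2 hev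
  refine ⟨e₀.restrOpen U isOpen_interior, rfl, ⟨ha₀, haU⟩, fun z hz => ?_, fun y hy => ?_⟩
  · exact (show z ∈ {z | good z ∧ AnalyticAt ℝ e₀.symm (Θ z)} from interior_subset hz.2).1
  · have hy' : y ∈ e₀.target ∧ e₀.symm y ∈ U := by
      have h1 := (e₀.restrOpen U isOpen_interior).map_target hy
      have h2 := (e₀.restrOpen U isOpen_interior).right_inv hy
      refine ⟨?_, h1.2⟩
      rw [← h2]
      exact e₀.map_source h1.1
    have := (show e₀.symm y ∈ {z | good z ∧ AnalyticAt ℝ e₀.symm (Θ z)} from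
      interior_subset hy'.2).2
    rwa [show Θ (e₀.symm y) = y from e₀.right_inv hy'.1] at this

/-- Local uniqueness of solutions of an autonomous ODE to the right of the initial time. -/
theorem exists_eqOn_of_hasDerivWithinAt {f : E → E} {x₀ : E} (hf : ContDiffAt ℝ 1 f x₀)
    {c w : ℝ → E} {T : ℝ} (hT : 0 < T) (hc0 : c 0 = x₀) (hw0 : w 0 = x₀)
    (hc : ∀ᶠ t in 𝓝[≥] 0, HasDerivWithinAt c (f (c t)) (Icc 0 T) t)
    (hw : ∀ᶠ t in 𝓝 0, HasDerivAt w (f (w t)) t) :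
    ∃ δ, 0 < δ ∧ δ ≤ T ∧ ∀ t ∈ Icc 0 δ, c t = w t := by
  obtain ⟨k, s, hs, hlip⟩ := hf.exists_lipschitzOnWith
  have hIcc : 𝓝[Icc 0 T] (0 : ℝ) = 𝓝[≥] 0 := nhdsWithin_Icc_eq_nhdsGE hT
  have hcc : Filter.Tendsto c (𝓝[≥] 0) (𝓝 x₀) := by
    have := (hc.self_of_nhdsWithin (self_mem_Ici)).continuousWithinAt
    rwa [ContinuousWithinAt, hc0, hIcc] at this
  have hwc : Filter.Tendsto w (𝓝[≥] 0) (𝓝 x₀) := by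
    have := hw.self_of_nhds.continuousAt
    rw [ContinuousAt, hw0] at this
    exact this.mono_left nhdsWithin_le_nhds
  have hall : ∀ᶠ t in 𝓝[≥] (0 : ℝ), (HasDerivWithinAt c (f (c t)) (Icc 0 T) t ∧
      HasDerivAt w (f (w t)) t) ∧ (c t ∈ s ∧ w t ∈ s) ∧ t < T := by
    refine (hc.and (hw.filter_mono nhdsWithin_le_nhds)).and
      (((hcc.eventually_mem hs).and (hwc.eventually_mem hs)).and ?_)
    exact nhdsWithin_le_nhds (Iio_mem_nhds hT)
  obtain ⟨δ, hδ, hδ'⟩ := (mem_nhdsGE_iff_exists_Icc_subset).1 hall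
  have hδ0 : (0 : ℝ) < δ := hδ
  refine ⟨δ, hδ0, (hδ' (right_mem_Icc.2 hδ0.le)).2.2.le, ?_⟩
  refine ODE_solution_unique_of_mem_Icc_right (v := fun _ => f) (s := fun _ => s) (K := k)
    (fun _ _ => hlip) ?_ ?_ ?_ ?_ ?_ ?_ (hc0.trans hw0.symm)
  · exact fun t ht => (hδ' ht).1.1.continuousWithinAt.mono
      (Icc_subset_Icc_right (hδ' (right_mem_Icc.2 hδ0.le)).2.2.le)
  · intro t ht
    have h := hδ' (Ico_subset_Icc_self ht)
    refine h.1.1.mono_of_mem_nhdsWithin ?_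
    exact Filter.mem_of_superset (Icc_mem_nhdsGE h.2.2) (Icc_subset_Icc_left ht.1)
  · exact fun t ht => (hδ' (Ico_subset_Icc_self ht)).2.1.1
  · exact fun t ht => (hδ' ht).1.2.continuousAt.continuousWithinAt
  · exact fun t ht => (hδ' (Ico_subset_Icc_self ht)).1.2.hasDerivWithinAt
  · exact fun t ht => (hδ' (Ico_subset_Icc_self ht)).2.1.2

end Local

/-! ### Charts and canonical coordinates on the cotangent bundle -/

section Manifold

variable {n : ℕ} {M : Type*} [TopologicalSpace M] [ChartedSpace (Rn n) M]

theorem mdifferentiableAt_of_mem_maximalAtlas {φ : OpenPartialHomeomorph M (Rn n)}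
    (hφ : φ ∈ IsManifold.maximalAtlas (𝓡 n) ω M) {x : M} (hx : x ∈ φ.source) :
    MDifferentiableAt (𝓡 n) (𝓡 n) φ x :=
  ((contMDiffOn_of_mem_maximalAtlas hφ).contMDiffAt (φ.open_source.mem_nhds hx)).mdifferentiableAt
    (by simp)

theorem mdifferentiableAt_symm_of_mem_maximalAtlas {φ : OpenPartialHomeomorph M (Rn n)}
    (hφ : φ ∈ IsManifold.maximalAtlas (𝓡 n) ω M) {y : Rn n} (hy : y ∈ φ.target) :
    MDifferentiableAt (𝓡 n) (𝓡 n) φ.symm y :=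
  ((contMDiffOn_symm_of_mem_maximalAtlas hφ).contMDiffAt
    (φ.open_target.mem_nhds hy)).mdifferentiableAt (by simp)

/-- Post-composing a chart of a real-analytic manifold with an analytic diffeomorphism gives a
chart. -/
theorem trans_mem_maximalAtlas [IsManifold (𝓡 n) ω M] {φ : OpenPartialHomeomorph M (Rn n)}
    (hφ : φ ∈ IsManifold.maximalAtlas (𝓡 n) ω M) {e : OpenPartialHomeomorph (Rn n) (Rn n)}
    (he : AnalyticOnNhd ℝ e e.source) (he' : AnalyticOnNhd ℝ e.symm e.target) :
    φ ≫ₕ e ∈ IsManifold.maximalAtlas (𝓡 n) ω M := by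
  have heG : e ∈ contDiffGroupoid ω (𝓡 n) := by
    rw [contDiffGroupoid, mem_groupoid_of_pregroupoid]
    constructor
    · simpa [contDiffPregroupoid] using! he.contDiffOn e.open_source.uniqueDiffOn
    · simpa [contDiffPregroupoid] using! he'.contDiffOn e.open_target.uniqueDiffOn
  rw [IsManifold.mem_maximalAtlas_iff, mem_maximalAtlas_iff] at hφ ⊢
  intro e' he'
  obtain ⟨h1, h2⟩ := hφ e' he'
  constructor
  · rw [OpenPartialHomeomorph.trans_symm_eq_symm_trans_symm, OpenPartialHomeomorph.trans_assoc]
    exact (contDiffGroupoid ω (𝓡 n)).trans ((contDiffGroupoid ω (𝓡 n)).symm heG) h1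
  · rw [← OpenPartialHomeomorph.trans_assoc]
    exact (contDiffGroupoid ω (𝓡 n)).trans h2 heG

/-- A real-analytic function on the cotangent bundle is real-analytic in canonical coordinates. -/
theorem analyticAt_comp_cotangentLiftInv [IsManifold (𝓡 n) ω M] {H : CotangentBundle n M → ℝ}
    (hH : ContMDiff ((𝓡 n).prod 𝓘(ℝ, Rn n →L[ℝ] ℝ)) 𝓘(ℝ) ω H) (x₀ : M) {z : Rn n × Rn n}
    (hz : z.1 ∈ (chartAt (Rn n) x₀).target) :
    AnalyticAt ℝ (H ∘ cotangentLiftInv (chartAt (Rn n) x₀)) z := by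
  let φ := chartAt (Rn n) x₀
  have hφ : φ ∈ IsManifold.maximalAtlas (𝓡 n) ω M := IsManifold.chart_mem_maximalAtlas x₀
  have hsymm : ContMDiffAt 𝓘(ℝ, Rn n × Rn n) (𝓡 n) ω (fun z : Rn n × Rn n => φ.symm z.1) z := by
    have h1 : ContMDiffAt (𝓡 n) (𝓡 n) ω φ.symm z.1 :=
      (contMDiffOn_symm_of_mem_maximalAtlas hφ).contMDiffAt (φ.open_target.mem_nhds hz)
    exact h1.comp z contDiffAt_fst.contMDiffAt
  have hlift : ContMDiffAt 𝓘(ℝ, Rn n × Rn n) ((𝓡 n).prod 𝓘(ℝ, Rn n →L[ℝ] ℝ)) ω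
      (cotangentLiftInv φ) z := by
    rw [Bundle.Trivialization.contMDiffAt_iff
      (e := trivializationAt (Rn n →L[ℝ] ℝ) (fun q : M => CotangentSpace n q) x₀)]
    · refine ⟨hsymm, ?_⟩
      have h2 : ContMDiffAt 𝓘(ℝ, Rn n × Rn n) 𝓘(ℝ, Rn n →L[ℝ] ℝ) ω
          (fun z : Rn n × Rn n => innerSL ℝ z.2) z :=
        ((innerSL ℝ).contDiff.contDiffAt.comp z contDiffAt_snd).contMDiffAt
      -- In the trivialization at `x₀` the covector reads `⟪z.2, ·⟫`, since the derivatives of the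
      -- chart and of its inverse cancel.
      refine h2.congr_of_eventuallyEq ?_
      filter_upwards [continuousAt_fst.eventually (φ.open_target.mem_nhds hz)] with y hy
      rw [hom_trivializationAt_apply]
      ext v
      have hy1 : φ.symm y.1 ∈ φ.source := φ.map_target hy
      have hr : φ (φ.symm y.1) = y.1 := φ.right_inv hy
      have hinv := mfderiv_extChartAt_comp_mfderivWithin_extChartAt_symm (I := 𝓡 n) (x := x₀)
        (y := y.1) (by
          rw [extChartAt_target]
          simpa using! hy)
      simp only [cotangentLiftInv, ContinuousLinearMap.inCoordinates,
        Trivial.fiberBundle_trivializationAt', Trivial.continuousLinearMapAt_trivialization,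
        ContinuousLinearMap.id_comp]
      rw [TangentBundle.symmL_trivializationAt hy1]
      have hr' : extChartAt (𝓡 n) x₀ (φ.symm y.1) = y.1 := by simpa using hr
      rw [hr']
      exact congrArg (fun T => inner ℝ y.2 (T v)) hinv
    · rw [Bundle.Trivialization.mem_source]
      simpa using! φ.map_target hz
  have := (hH _).comp z hlift
  exact (contMDiffAt_iff_contDiffAt.1 this).analyticAt

/-- The inverse `e.symm` appears because `e` will be `Θ`, which maps the new coordinates to the old
ones. -/
theorem mfderiv_trans_symm {φ : OpenPartialHomeomorph M (Rn n)}
    (hφ : φ ∈ IsManifold.maximalAtlas (𝓡 n) ω M) {e : OpenPartialHomeomorph (Rn n) (Rn n)}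
    {x : M} (hx : x ∈ φ.source) (he : DifferentiableAt ℝ e.symm (φ x)) :
    mfderiv (𝓡 n) (𝓡 n) (φ ≫ₕ e.symm) x =
      (fderiv ℝ e.symm (φ x)).comp (mfderiv (𝓡 n) (𝓡 n) φ x : TangentSpace (𝓡 n) x →L[ℝ] Rn n) := by
  have h := mfderiv_comp (I := 𝓡 n) (I' := 𝓡 n) (I'' := 𝓡 n) (g := e.symm) (f := φ) x
    he.mdifferentiableAt (mdifferentiableAt_of_mem_maximalAtlas hφ hx)
  rw [mfderiv_eq_fderiv] at h
  exact h

theorem mfderiv_trans_symm_symm {φ : OpenPartialHomeomorph M (Rn n)}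
    (hφ : φ ∈ IsManifold.maximalAtlas (𝓡 n) ω M) {e : OpenPartialHomeomorph (Rn n) (Rn n)}
    {y : Rn n} (hy : e y ∈ φ.target) (he : DifferentiableAt ℝ e y) :
    mfderiv (𝓡 n) (𝓡 n) (φ ≫ₕ e.symm).symm y =
      (mfderiv (𝓡 n) (𝓡 n) φ.symm (e y)).comp (fderiv ℝ e y) := by
  have h := mfderiv_comp (I := 𝓡 n) (I' := 𝓡 n) (I'' := 𝓡 n) (g := φ.symm) (f := e) y
    (mdifferentiableAt_symm_of_mem_maximalAtlas hφ hy) he.mdifferentiableAt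
  rw [mfderiv_eq_fderiv] at h
  exact h

/-- The inverse cotangent lift of a chart followed by a diffeomorphism `e⁻¹` of `ℝⁿ`. -/
theorem cotangentLiftInv_trans_symm {φ : OpenPartialHomeomorph M (Rn n)}
    (hφ : φ ∈ IsManifold.maximalAtlas (𝓡 n) ω M) {e : OpenPartialHomeomorph (Rn n) (Rn n)}
    {y η η' : Rn n} (hy : e y ∈ φ.target) (he : DifferentiableAt ℝ e.symm (e y))
    (hη : ∀ v, inner ℝ η' v = inner ℝ η (fderiv ℝ e.symm (e y) v)) :
    cotangentLiftInv (φ ≫ₕ e.symm) (y, η) = cotangentLiftInv φ (e y, η') := by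
  have hr : φ (φ.symm (e y)) = e y := φ.right_inv hy
  have h := mfderiv_trans_symm hφ (e := e) (x := φ.symm (e y)) (φ.map_target hy) (by rwa [hr])
  rw [hr] at h
  unfold cotangentLiftInv
  refine congrArg (TotalSpace.mk (φ.symm (e y))) ?_
  ext v
  have h' := congrArg (fun T => T v) h
  refine Eq.trans ?_ (hη _).symm
  exact congrArg (inner ℝ η) h'

/-- The cotangent lift of a chart followed by a diffeomorphism `e⁻¹` of `ℝⁿ`. -/
theorem cotangentLift_trans_symm {φ : OpenPartialHomeomorph M (Rn n)}
    (hφ : φ ∈ IsManifold.maximalAtlas (𝓡 n) ω M) {e : OpenPartialHomeomorph (Rn n) (Rn n)}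
    {x : CotangentBundle n M} (hx : x.1 ∈ φ.source) (hx' : φ x.1 ∈ e.target)
    (he : DifferentiableAt ℝ e (e.symm (φ x.1))) (v : Rn n) :
    inner ℝ (cotangentLift (φ ≫ₕ e.symm) x).2 v =
      inner ℝ (cotangentLift φ x).2 (fderiv ℝ e (e.symm (φ x.1)) v) := by
  have hr : e (e.symm (φ x.1)) = φ x.1 := e.right_inv hx'
  have h := mfderiv_trans_symm_symm hφ (e := e) (y := e.symm (φ x.1))
    (by rw [hr]; exact φ.map_source hx) he
  rw [hr] at h
  unfold cotangentLift
  rw [InnerProductSpace.toDual_symm_apply, InnerProductSpace.toDual_symm_apply]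
  have h' := congrArg (fun T => T v) h
  exact congrArg x.2 h'

end Manifold

end SubbundleHamiltonian

namespace SubbundleHamiltonian

/-! ### Assembling the normal form -/

section NormalForm

theorem fderiv_symm_fderiv {E : Type*} [NormedAddCommGroup E] [NormedSpace ℝ E]
    {e : OpenPartialHomeomorph E E} {z : E} (hz : z ∈ e.source) (he : DifferentiableAt ℝ e z)
    (he' : DifferentiableAt ℝ e.symm (e z)) (v : E) :
    fderiv ℝ e.symm (e z) (fderiv ℝ e z v) = v := by
  have h := (he'.hasFDerivAt.comp z he.hasFDerivAt).congr_of_eventuallyEq (f₁ := id) (by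
    filter_upwards [e.open_source.mem_nhds hz] with y hy using (e.left_inv hy).symm)
  have h' := h.unique (hasFDerivAt_id z)
  exact congrArg (fun T => T v) h'

variable {n : ℕ} {M : Type*} [TopologicalSpace M] [ChartedSpace (Rn n) M]

/-- A curve whose coordinate expression has vanishing derivative has vanishing velocity. -/
theorem mfderivWithin_eq_zero_of_hasDerivWithinAt {γ : ℝ → M} {s : Set ℝ} {t : ℝ}
    (hs : UniqueDiffWithinAt ℝ s t)
    (h : HasDerivWithinAt (fun r => chartAt (Rn n) (γ t) (γ r)) 0 s t) :
    mfderivWithin 𝓘(ℝ) (𝓡 n) γ s t (1 : ℝ) = 0 := by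
  by_cases hd : MDifferentiableWithinAt 𝓘(ℝ) (𝓡 n) γ s t
  · have h0 : fderivWithin ℝ (fun r => chartAt (Rn n) (γ t) (γ r)) s t = 0 := by
      rw [h.hasFDerivWithinAt.fderivWithin hs]
      ext
      simp
    rw [hd.mfderivWithin]
    simp only [mfld_simps]
    exact congrArg (fun T => T (1 : ℝ)) h0
  -- Without differentiability the derivative is zero by default.
  · rw [mfderivWithin_zero_of_not_mdifferentiableWithinAt hd]
    rfl

end NormalForm

end SubbundleHamiltonian

theorem proposition2 {n m : ℕ} (hmn : m < n)
    {M : Type*} [TopologicalSpace M] [ChartedSpace (SubbundleHamiltonian.Rn n) M]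
    [IsManifold (𝓡 n) ω M]
    (D : ∀ q : M, Submodule ℝ (TangentSpace (𝓡 n) q))
    (hD : SubbundleHamiltonian.IsAnalyticDistribution m D)
    (H₀ : SubbundleHamiltonian.CotangentBundle n M → ℝ)
    (hH₀ : SubbundleHamiltonian.IsAnalyticDHamiltonian D H₀)
    (T : ℝ) (hT : 0 < T)
    (θ₀ : ℝ → SubbundleHamiltonian.CotangentBundle n M)
    (hθ₀ : SubbundleHamiltonian.IsHamiltonianOrbit H₀ T θ₀)
    (hQ : mfderivWithin 𝓘(ℝ) (𝓡 n) (fun t => (θ₀ t).1) (Icc 0 T) 0 (1 : ℝ) ≠ 0) :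
    let e₁ : SubbundleHamiltonian.Rn n :=
      EuclideanSpace.single (⟨0, Nat.zero_lt_of_lt hmn⟩ : Fin n) (1 : ℝ)
    ∃ (δ : ℝ) (φ : OpenPartialHomeomorph M (SubbundleHamiltonian.Rn n))
      (g : SubbundleHamiltonian.Rn n → ℝ),
      0 < δ ∧ δ ≤ T ∧
      φ ∈ IsManifold.maximalAtlas (𝓡 n) ω M ∧
      (θ₀ 0).1 ∈ φ.source ∧ φ (θ₀ 0).1 = 0 ∧
      AnalyticOnNhd ℝ g φ.target ∧
      let Φ : SubbundleHamiltonian.Rn n × SubbundleHamiltonian.Rn n →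
          SubbundleHamiltonian.CotangentBundle n M :=
        SubbundleHamiltonian.cotangentLiftInv φ ∘ (SubbundleHamiltonian.fiberTranslation g).symm
      let H : SubbundleHamiltonian.Rn n × SubbundleHamiltonian.Rn n → ℝ := H₀ ∘ Φ
      (∀ t ∈ Icc 0 δ, (θ₀ t).1 ∈ φ.source ∧
        SubbundleHamiltonian.fiberTranslation g (SubbundleHamiltonian.cotangentLift φ (θ₀ t)) =
          (t • e₁, 0)) ∧
      (∀ q ∈ φ.target, ∀ t ∈ Icc 0 δ, H (q, 0) = H (t • e₁, 0)) ∧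
      (∀ q ∈ φ.target, HasGradientAt (fun p => H (q, p)) e₁ 0) := by
  intro e₁
  have he₁ : ‖e₁‖ = 1 := by simp [e₁]
  let φ₀ := chartAt (SubbundleHamiltonian.Rn n) (θ₀ 0).1
  have hφ₀ : φ₀ ∈ IsManifold.maximalAtlas (𝓡 n) ω M := IsManifold.chart_mem_maximalAtlas _
  have hx₀ : (θ₀ 0).1 ∈ φ₀.source := mem_chart_source _ _
  let K : SubbundleHamiltonian.Rn n × SubbundleHamiltonian.Rn n → ℝ :=
    H₀ ∘ SubbundleHamiltonian.cotangentLiftInv φ₀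
  let c : ℝ → SubbundleHamiltonian.Rn n × SubbundleHamiltonian.Rn n := fun t =>
    SubbundleHamiltonian.cotangentLift φ₀ (θ₀ t)
  have hK : AnalyticAt ℝ K (c 0) :=
    SubbundleHamiltonian.analyticAt_comp_cotangentLiftInv hH₀.analytic _ (φ₀.map_source hx₀)
  have hham : ∀ t ∈ Icc (0 : ℝ) T, (θ₀ t).1 ∈ φ₀.source → AnalyticAt ℝ K (c t) →
      HasDerivWithinAt c (SubbundleHamiltonian.gradSnd K (c t),
        -SubbundleHamiltonian.gradFst K (c t)) (Icc 0 T) t := by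
    intro t ht hsrc hKt
    obtain ⟨h1, h2⟩ := hθ₀.hamilton φ₀ hφ₀ t ht hsrc
    have e1 : SubbundleHamiltonian.gradp K (c t) = SubbundleHamiltonian.gradSnd K (c t) :=
      (SubbundleHamiltonian.hasGradientAt_snd hKt.differentiableAt).gradient
    have e2 : SubbundleHamiltonian.gradq K (c t) = SubbundleHamiltonian.gradFst K (c t) :=
      (SubbundleHamiltonian.hasGradientAt_fst hKt.differentiableAt).gradient
    rw [← e1, ← e2]
    exact h1.prodMk h2
  have h0T : (0 : ℝ) ∈ Icc 0 T := left_mem_Icc.2 hT.le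
  -- By Hamilton's equations, `∂_p K` at the initial point is the coordinate velocity of the base
  -- curve.
  have hv : SubbundleHamiltonian.gradSnd K (c 0) ≠ 0 := by
    intro hv
    refine hQ (SubbundleHamiltonian.mfderivWithin_eq_zero_of_hasDerivWithinAt
      (uniqueDiffOn_Icc hT 0 h0T) ?_)
    have h1 : HasDerivWithinAt (fun t => (c t).1) (SubbundleHamiltonian.gradSnd K (c 0))
        (Icc 0 T) 0 :=
      (hham 0 h0T hx₀ hK).hasFDerivWithinAt.fst.hasDerivWithinAt.congr_deriv (by simp)
    rw [hv] at h1
    exact h1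
  obtain ⟨Θ, η, S, A, hΘ0, hη0, hA, hev⟩ :=
    SubbundleHamiltonian.exists_hamiltonJacobi_coordinates he₁ (q₀ := (c 0).1) (p₀ := (c 0).2)
      hK hv
  have hΘ : AnalyticAt ℝ Θ 0 := hev.self_of_nhds.2.1
  obtain ⟨e, heΘ, he0, hgood, hsymm⟩ :=
    SubbundleHamiltonian.exists_analytic_openPartialHomeomorph hΘ hA hev
  subst heΘ
  let φ := φ₀ ≫ₕ e.symm
  have hfd : ∀ z ∈ e.source, DifferentiableAt ℝ e z := fun z hz =>
    (hgood z hz).2.1.differentiableAt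
  have hfd' : ∀ z ∈ e.source, DifferentiableAt ℝ e.symm (e z) := fun z hz =>
    (hsymm _ (e.map_source hz)).differentiableAt
  have hφ : φ ∈ IsManifold.maximalAtlas (𝓡 n) ω M :=
    SubbundleHamiltonian.trans_mem_maximalAtlas hφ₀ hsymm fun z hz => (hgood z hz).2.1
  have htarget : ∀ z ∈ φ.target, z ∈ e.source ∧ e z ∈ φ₀.target := fun z hz => by
    rw [OpenPartialHomeomorph.trans_target] at hz
    exact hz
  -- In the coordinates `Θ` the covector `η` reads `dS`, so adding `dg = -dS` moves it to zero.
  let g : SubbundleHamiltonian.Rn n → ℝ := fun z => -S z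
  have hg : ∀ z v, inner ℝ (∇ g z) v = -fderiv ℝ S z v := fun z v => by
    rw [gradient, InnerProductSpace.toDual_symm_apply, fderiv_fun_neg]
    rfl
  -- In the old coordinates `Φ` is affine on fibres, with base value `η z` and linear part the
  -- transpose of `D(e⁻¹)`. Energy constancy and the momentum gradient are both read off from this
  -- formula.
  have hΦ : ∀ z ∈ φ.target, ∀ p, (H₀ ∘ SubbundleHamiltonian.cotangentLiftInv φ ∘
      (SubbundleHamiltonian.fiberTranslation g).symm) (z, p) =
        K (e z, η z + ContinuousLinearMap.adjoint (fderiv ℝ e.symm (e z)) p) := by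
    intro z hz p
    obtain ⟨hze, hzφ⟩ := htarget z hz
    refine congrArg H₀ (SubbundleHamiltonian.cotangentLiftInv_trans_symm hφ₀ hzφ (hfd' z hze)
      fun v => ?_)
    have hinv : fderiv ℝ e z (fderiv ℝ e.symm (e z) v) = v := by
      have := SubbundleHamiltonian.fderiv_symm_fderiv (e := e.symm) (e.map_source hze)
        (hfd' z hze) (by simpa [e.left_inv hze] using hfd z hze) v
      simpa [e.left_inv hze] using this
    change _ = inner ℝ (p - ∇ g z) _
    rw [inner_add_left, inner_sub_left, hg, (hgood z hze).2.2.2.2.2.2.2, hinv,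
      ContinuousLinearMap.adjoint_inner_left]
    ring
  let f : SubbundleHamiltonian.Rn n × SubbundleHamiltonian.Rn n →
      SubbundleHamiltonian.Rn n × SubbundleHamiltonian.Rn n := fun z =>
    (SubbundleHamiltonian.gradSnd K z, -SubbundleHamiltonian.gradFst K z)
  have hf : AnalyticAt ℝ f (c 0) := (SubbundleHamiltonian.analyticAt_gradSnd hK).prod
    (SubbundleHamiltonian.analyticAt_gradFst hK).neg
  have hIcc : 𝓝[Icc 0 T] (0 : ℝ) = 𝓝[≥] 0 := nhdsWithin_Icc_eq_nhdsGE hT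
  have hQc : ∀ᶠ t in 𝓝[≥] (0 : ℝ), (θ₀ t).1 ∈ φ₀.source := by
    have hcont : ContinuousWithinAt (fun t => (θ₀ t).1) (Icc 0 T) 0 :=
      (FiberBundle.continuous_proj _ _).continuousAt.comp_continuousWithinAt
        (hθ₀.continuousOn 0 h0T)
    rw [ContinuousWithinAt, hIcc] at hcont
    exact hcont (φ₀.open_source.mem_nhds hx₀)
  have hline : Filter.Tendsto (fun t : ℝ => t • e₁) (𝓝 0) (𝓝 0) :=
    Continuous.tendsto' (by fun_prop) _ _ (by simp)
  have hsource : ∀ᶠ t in 𝓝 (0 : ℝ), t • e₁ ∈ e.source := hline (e.open_source.mem_nhds he0)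
  -- Along the line `t • e₁` the pair `(e, η)` solves Hamilton's equations with the initial value of
  -- the given orbit.
  obtain ⟨δ₁, hδ₁, hδ₁T, heq⟩ := SubbundleHamiltonian.exists_eqOn_of_hasDerivWithinAt
    (f := f) (c := c) (w := fun t => (e (t • e₁), η (t • e₁))) hf.contDiffAt hT rfl
    (by simp [hΘ0, hη0])
    (by
      have hcc := (hham 0 h0T hx₀ hK).continuousWithinAt
      rw [ContinuousWithinAt, hIcc] at hcc
      filter_upwards [hQc, hcc.eventually hK.eventually_analyticAt, hIcc ▸ self_mem_nhdsWithin]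
        with t h1 h2 h3 using hham t h3 h1 h2)
    (by
      filter_upwards [hsource] with t ht
      obtain ⟨-, h1, h2, -, -, h3, h4, -⟩ := hgood _ ht
      have hl : HasDerivAt (fun t : ℝ => t • e₁) e₁ t := by
        simpa using (hasDerivAt_id t).smul_const e₁
      have d1 := h1.differentiableAt.hasFDerivAt.comp_hasDerivAt t hl
      have d2 := h2.differentiableAt.hasFDerivAt.comp_hasDerivAt t hl
      rw [h3] at d1
      rw [h4] at d2
      exact d1.prodMk d2)
  obtain ⟨δ₂, hδ₂, hδ₂'⟩ := (mem_nhdsGE_iff_exists_Icc_subset).1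
    (hQc.and (hsource.filter_mono nhdsWithin_le_nhds))
  have horbit : ∀ t ∈ Icc 0 (min δ₁ δ₂), (θ₀ t).1 ∈ φ.source ∧ φ (θ₀ t).1 = t • e₁ ∧
      t • e₁ ∈ e.source ∧ φ₀ (θ₀ t).1 = e (t • e₁) ∧ (c t).2 = η (t • e₁) := by
    intro t ht
    have h1 := heq t ⟨ht.1, ht.2.trans (min_le_left _ _)⟩
    obtain ⟨h2, h3⟩ := hδ₂' ⟨ht.1, ht.2.trans (min_le_right _ _)⟩
    have h4 : φ₀ (θ₀ t).1 = e (t • e₁) := congrArg Prod.fst h1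
    refine ⟨?_, ?_, h3, h4, congrArg Prod.snd h1⟩
    · rw [OpenPartialHomeomorph.trans_source]
      refine ⟨h2, ?_⟩
      rw [mem_preimage, h4]
      exact e.map_source h3
    · change e.symm (φ₀ (θ₀ t).1) = _
      rw [h4, e.left_inv h3]
  have hδ : 0 < min δ₁ δ₂ := lt_min hδ₁ hδ₂
  have horbit0 := horbit 0 ⟨le_rfl, hδ.le⟩
  have henergy : ∀ z ∈ φ.target, (H₀ ∘ SubbundleHamiltonian.cotangentLiftInv φ ∘
      (SubbundleHamiltonian.fiberTranslation g).symm) (z, 0) = K (c 0) := by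
    intro z hz
    rw [hΦ z hz, map_zero, add_zero]
    exact (hgood z (htarget z hz).1).2.2.2.2.1
  refine ⟨min δ₁ δ₂, φ, g, hδ, (min_le_left _ _).trans hδ₁T, hφ, horbit0.1, by
    simpa using horbit0.2.1, fun z hz => (hgood z (htarget z hz).1).2.2.2.1.neg, ?_, ?_, ?_⟩
  · intro t ht
    obtain ⟨h1, h2, h3, h4, h5⟩ := horbit t ht
    refine ⟨h1, Prod.ext h2 ?_⟩
    change (SubbundleHamiltonian.cotangentLift φ (θ₀ t)).2 + ∇ g (φ (θ₀ t).1) = 0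
    refine ext_inner_right ℝ fun v => ?_
    have hsrc : (θ₀ t).1 ∈ φ₀.source := (hδ₂' ⟨ht.1, ht.2.trans (min_le_right _ _)⟩).1
    have h6 : e.symm (φ₀ (θ₀ t).1) = t • e₁ := h2
    rw [inner_add_left, SubbundleHamiltonian.cotangentLift_trans_symm hφ₀ hsrc
      (by rw [h4]; exact e.map_source h3) (by rw [h6]; exact hfd _ h3), h2, hg, h6,
      (hgood _ h3).2.2.2.2.2.2.2]
    change inner ℝ (c t).2 _ + _ = _
    rw [h5, add_neg_cancel, inner_zero_left]
  · intro z hz t ht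
    have h1 := horbit t ht
    rw [henergy z hz]
    refine (henergy _ ?_).symm
    rw [← h1.2.1]
    exact φ.map_source h1.1
  · intro z hz
    obtain ⟨hze, hzφ⟩ := htarget z hz
    have hgz := hgood z hze
    let D := fderiv ℝ e.symm (e z)
    -- By the chain rule the new gradient is `D(∂_p K)`, and `∂_p K` is the `e₁`-derivative of `e`,
    -- which `D` inverts.
    have hinv : D (fderiv ℝ e z e₁) = e₁ :=
      SubbundleHamiltonian.fderiv_symm_fderiv hze (hfd z hze) (hfd' z hze) e₁
    have hfun : (fun p => (H₀ ∘ SubbundleHamiltonian.cotangentLiftInv φ ∘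
        (SubbundleHamiltonian.fiberTranslation g).symm) (z, p)) =
          fun p => K (e z, η z + ContinuousLinearMap.adjoint D p) := funext (hΦ z hz)
    change HasGradientAt (fun p => (H₀ ∘ SubbundleHamiltonian.cotangentLiftInv φ ∘
        (SubbundleHamiltonian.fiberTranslation g).symm) (z, p)) e₁ 0
    rw [hfun, hasGradientAt_iff_hasFDerivAt]
    have hK' := (SubbundleHamiltonian.hasGradientAt_snd hgz.1.differentiableAt).hasFDerivAt
    have hcomp := HasFDerivAt.comp (g := fun p => K (e z, p))
      (f := fun p => η z + ContinuousLinearMap.adjoint D p) 0 (by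
        simpa only [map_zero, add_zero] using hK')
      ((ContinuousLinearMap.adjoint D).hasFDerivAt.const_add (η z))
    convert! hcomp using 1
    ext v
    simp only [ContinuousLinearMap.comp_apply, InnerProductSpace.toDual_apply_apply,
      ContinuousLinearMap.adjoint_inner_right]
    rw [← hgz.2.2.2.2.2.1, hinv]
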